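/- Let $A,B$ be real symmetric $4\times 4$ matrices, and let $\mathrm{QSIC}=\{[X]\in\mathbb{PR}^3 : X^TAX=X^TBX=0\}$ be the real intersection of the quadrics $X^TAX=0$ and $X^TBX=0$. Assume that the characteristic equation $f(\lambda)=\det(\lambda A-B)=0$, with $\lambda\in\mathbb{PR}^1$, has four distinct real roots; that is, the binary quartic form $\det(\lambda A-\mu B)$ has exactly four real zeros $[\lambda:\mu]$, where $\lambda=\infty$ is a root when $A$ is singular. Index sequences. The index of a real symmetric matrix is the number of positive entries in its Sylvester normal form. A representative of the pencil is a pair $A'=aA+bB$, $B'=cA+dB$ with $a,b,c,d\in\mathbb R$, $ad-bc\neq 0$ and $A'$ nonsingular (such as $(A,B)$ itself if $A$ is nonsingular). Let $\lambda_1<\dots<\lambda_r$ be the distinct real roots of $\det(\lambda A'-B')$; let $s_0$ and $s_r$ be the values of $\mathrm{index}(\lambda A'-B')$ for $\lambda$ near $-\infty$ and near $+\infty$, and $s_j$ its value on $(\lambda_j,\lambda_{j+1})$ for $0<j<r$. One says that the index sequence of $(A',B')$ is $\langle s_0|s_1|\cdots|s_r\rangle$ if moreover to each $\lambda_j$ belongs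 a single Jordan block of $A'^{-1}B'$, of size $1\times1$. Index sequences (with $0\le s_j\le 4$ and $s_0+s_r=4$) are considered up to the equivalence relation $\sim$ generated by the rotations $$\langle s_0|s_1|\cdots|s_r\rangle\sim\langle 4-s_{r-1}|s_0|\cdots|s_{r-1}\rangle,\qquad \langle s_0|s_1|\cdots|s_r\rangle\sim\langle s_1|\cdots|s_r|4-s_1\rangle,$$ the reversal $\langle s_0|\cdots|s_r\rangle\sim\langle s_r|\cdots|s_0\rangle$ and the complement $\langle s_0|\cdots|s_r\rangle\sim\langle 4-s_0|\cdots|4-s_r\rangle$. Then the pencil has a representative; every representative has an index sequence of the form $\langle s_0|\cdots|s_r\rangle$; and each such index sequence is equivalent to $\langle 1|2|1|2|3\rangle$ or to $\langle 0|1|2|3|4\rangle$. Furthermore: 1. if it is equivalent to $\langle 1|2|1|2|3\rangle$, then the QSIC has exactly two connected components, and both are ovals, i.e. each of them is homeomorphic to a circle and is closed in the sense that some plane of $\mathbb{PR}^3$ does not meet it; 2. if it is equivalent to $\langle 0|1|2|3|4\rangle$, then the QSIC is empty in $\mathbb{PR}^3$. -/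

import Mathlib

open scoped LinearAlgebra.Projectivization Matrix

namespace QuadricPencil

/-! ### Real projective space and intersections of quadrics -/

/-- Real projective space of dimension `n`. -/
abbrev RealProj (n : ℕ) : Type := ℙ ℝ (Fin (n + 1) → ℝ)

/-- Real projective space carries the quotient topology from the nonzero vectors. -/
noncomputable instance instTopologicalSpaceRealProj (n : ℕ) : TopologicalSpace (RealProj n) :=
  TopologicalSpace.coinduced
    (Projectivization.mk' ℝ : {v : Fin (n + 1) → ℝ // v ≠ 0} → RealProj n) inferInstance

/-- The intersection of the two quadrics `Xᵀ A X = 0` and `Xᵀ B X = 0` in `ℙℝ³`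
(all real points of it). -/
def qsic (A B : Matrix (Fin 4) (Fin 4) ℝ) : Set (RealProj 3) :=
  {p | p.rep ⬝ᵥ (A *ᵥ p.rep) = 0 ∧ p.rep ⬝ᵥ (B *ᵥ p.rep) = 0}

/-- The choice of homogeneous coordinates is irrelevant for membership in `qsic`. -/
theorem mk_mem_qsic (A B : Matrix (Fin 4) (Fin 4) ℝ) (v : Fin 4 → ℝ) (hv : v ≠ 0) :
    (Projectivization.mk ℝ v hv : RealProj 3) ∈ qsic A B ↔
      v ⬝ᵥ (A *ᵥ v) = 0 ∧ v ⬝ᵥ (B *ᵥ v) = 0 := by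
  obtain ⟨a, ha⟩ := Projectivization.exists_smul_eq_mk_rep ℝ v hv
  have ha0 : (a : ℝ) ≠ 0 := a.ne_zero
  simp only [qsic, Set.mem_ofPred_eq, ← ha, Units.smul_def, Matrix.mulVec_smul, smul_dotProduct,
    dotProduct_smul, smul_eq_mul, mul_eq_zero, ha0, false_or]

/-- The plane `u₀ x + u₁ y + u₂ z + u₃ w = 0` of `ℙℝ³` (meaningful for `u ≠ 0`). -/
def plane (u : Fin 4 → ℝ) : Set (RealProj 3) :=
  {p | u ⬝ᵥ p.rep = 0}

/-- The connected components of a subset `S` of `ℙℝ³`. -/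
def components (S : Set (RealProj 3)) : Set (Set (RealProj 3)) :=
  {C | ∃ p ∈ S, C = connectedComponentIn S p}

/-- A set is *closed* in the sense of "closed curve component" if it misses some plane, i.e. if
it lies in some affine chart of `ℙℝ³`. -/
def MissesPlane (C : Set (RealProj 3)) : Prop :=
  ∃ u : Fin 4 → ℝ, u ≠ 0 ∧ Disjoint C (plane u)

/-- An oval: a topological circle which misses some plane. -/
def IsOval (C : Set (RealProj 3)) : Prop :=
  Nonempty (C ≃ₜ Circle) ∧ MissesPlane C

/-! ### The characteristic equation -/

/-- The real projective roots `[λ : μ]` of the characteristic form `det (λ A - μ B)`.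
The root `λ = ∞`, i.e. `[1 : 0]`, occurs exactly when `A` is singular. -/
def pencilRoots (A B : Matrix (Fin 4) (Fin 4) ℝ) : Set (RealProj 1) :=
  {p | (p.rep 0 • A - p.rep 1 • B).det = 0}

/-- The choice of homogeneous coordinates is irrelevant for membership in `pencilRoots`. -/
theorem mk_mem_pencilRoots (A B : Matrix (Fin 4) (Fin 4) ℝ) (v : Fin 2 → ℝ) (hv : v ≠ 0) :
    (Projectivization.mk ℝ v hv : RealProj 1) ∈ pencilRoots A B ↔
      (v 0 • A - v 1 • B).det = 0 := by
  obtain ⟨a, ha⟩ := Projectivization.exists_smul_eq_mk_rep ℝ v hv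
  have ha0 : (a : ℝ) ≠ 0 := a.ne_zero
  have h : ((a • v) 0 • A - (a • v) 1 • B) = (a : ℝ) • (v 0 • A - v 1 • B) := by
    simp [Units.smul_def, mul_smul, smul_sub]
  simp only [pencilRoots, Set.mem_ofPred_eq, ← ha, h, Matrix.det_smul, mul_eq_zero]
  simp [ha0]

/-- `A'` and `B'` span the same pencil as `A` and `B` (projective change of the parameter), and
`A'` is nonsingular, so that `∞` is not a root of `det (λ A' - B')`. -/
def IsRepresentative (A B A' B' : Matrix (Fin 4) (Fin 4) ℝ) : Prop :=
  (∃ a b c d : ℝ, a * d - b * c ≠ 0 ∧ A' = a • A + b • B ∧ B' = c • A + d • B) ∧ A'.det ≠ 0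

/-! ### Index sequences -/

/-- The index of a real symmetric matrix: the number of `+1`s in its Sylvester normal form. -/
noncomputable def index (D : Matrix (Fin 4) (Fin 4) ℝ) : ℕ :=
  sigPos (Matrix.toQuadraticForm' D)

/-- `HasBarIndexSequence A B s` says that `A` is nonsingular and that the index sequence of
`(A, B)` is `⟨s₀ | s₁ | ⋯ | s_r⟩`, where each bar `|` is a real root of `det (λ A - B)` to which
belongs a single Jordan block of `A⁻¹ B`, of size `1 × 1`.
Here `root 0 < ⋯ < root (r - 1)` are all the distinct real roots, `s₀` and `s_r` are the values of
the index function `λ ↦ index (λ A - B)` near `-∞` and `+∞`, and the remaining entries are its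
values between consecutive roots. -/
def HasBarIndexSequence (A B : Matrix (Fin 4) (Fin 4) ℝ) (s : List ℕ) : Prop :=
  A.det ≠ 0 ∧
  ∃ (r : ℕ) (root : Fin r → ℝ) (σ : Fin (r + 1) → ℕ),
    StrictMono root ∧
    (∀ x : ℝ, (x • A - B).det = 0 ↔ ∃ i, root i = x) ∧
    (∀ i, Module.finrank ℝ
      (Module.End.maxGenEigenspace (Matrix.toLin' (A⁻¹ * B)) (root i)) = 1) ∧
    (∀ᶠ μ : ℝ in Filter.atBot, index (μ • A - B) = σ 0) ∧
    (∀ᶠ μ : ℝ in Filter.atTop, index (μ • A - B) = σ (Fin.last r)) ∧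
    (∀ i j : Fin r, (j : ℕ) = i + 1 →
      ∀ μ : ℝ, root i < μ → μ < root j → index (μ • A - B) = σ i.succ) ∧
    s = List.ofFn σ

/-- The sequences on which the equivalence rules operate: entries in `{0, …, 4}`, and first and
last entry adding up to `4` (as holds whenever `A` is nonsingular). -/
def Admissible (s : List ℕ) : Prop :=
  (∀ x ∈ s, x ≤ 4) ∧ ∃ h : s ≠ [], s.head h + s.getLast h = 4

/-- The elementary equivalences of (bar) index sequences. -/
inductive IndexStep : List ℕ → List ℕ → Prop
  | rotateRight (l : List ℕ) (a b : ℕ) (h : Admissible (l ++ [a, b])) :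
      IndexStep (l ++ [a, b]) ((4 - a) :: (l ++ [a]))
  | rotateLeft (a b : ℕ) (l : List ℕ) (h : Admissible (a :: b :: l)) :
      IndexStep (a :: b :: l) ((b :: l) ++ [4 - b])
  | reversal (s : List ℕ) (h : Admissible s) : IndexStep s s.reverse
  | complement (s : List ℕ) (h : Admissible s) : IndexStep s (s.map (fun x => 4 - x))

/-- Equivalence of index sequences: the equivalence relation generated by rotation, reversal and
complement. -/
def IndexEquiv : List ℕ → List ℕ → Prop :=
  Relation.EqvGen IndexStep

end QuadricPencil

/-!
A representative `(A', B')` of the pencil sees all four roots as distinct real numbers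
`l 0 < l 1 < l 2 < l 3` (`IsRepresentative.exists_roots`), so the corresponding kernel vectors form a
basis that diagonalizes both forms (`exists_diagonalization`): in suitable coordinates `y` the form
`x A' - B'` is `∑ i, d i * (x - l i) * y i ^ 2` with all `d i ≠ 0`. By the law of inertia its index
counts positive coefficients, so the index sequence is determined by the signs of the `d i`
(`hasBarIndexSequence_signSeq`) and, up to rotation, one of two sequences (`signSeq_equiv`).

The two classes are told apart by whether the sequence has an entry `0` or `4`, a property invariant
under the elementary equivalences (`IndexEquiv.extreme_iff`). Such an entry is the index of a
definite member of the pencil, whose quadric is empty, and with it the intersection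
(`qsic_eq_empty`).

Otherwise, in every sign pattern two of the squares `y i ^ 2` can be solved for as combinations with
positive coefficients of the other two (`exists_indices_of_not_extreme`), so after a permutation of
the coordinates the curve is `y₂² = a y₀² + b y₁²`, `y₃² = c y₀² + d y₁²` with `a, b, c, d > 0`. There
`y₂` and `y₃` never vanish. Normalizing `y₂ > 0` and `y₀² + y₁² = 1`, each sign of `y₃` gives one
injectively parametrized circle, and both circles miss the plane `y₂ = 0` (`ovals_of_normal_form`).
-/

namespace QuadricPencil

/-! ### Simultaneous diagonalization of the pencil -/

/-- Kernel vectors at the four roots are eigenvectors of `A⁻¹ * B` for distinct eigenvalues, hence a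
basis, and by symmetry they are orthogonal for both forms. -/
theorem exists_diagonalization {A B : Matrix (Fin 4) (Fin 4) ℝ} (hA : A.IsSymm) (hB : B.IsSymm)
    (hdet : A.det ≠ 0) {l : Fin 4 → ℝ} (hl : Function.Injective l)
    (hroot : ∀ i, (l i • A - B).det = 0) :
    ∃ (W : Matrix (Fin 4) (Fin 4) ℝ) (d : Fin 4 → ℝ), (∀ i, d i ≠ 0) ∧
      Wᵀ * A * W = Matrix.diagonal d ∧ Wᵀ * B * W = Matrix.diagonal (fun i => d i * l i) := by
  choose w hw0 hw using fun i => Matrix.exists_mulVec_eq_zero_iff.2 (hroot i)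
  have hBw : ∀ i, B *ᵥ w i = l i • (A *ᵥ w i) := fun i => by
    have := hw i
    rw [Matrix.sub_mulVec, Matrix.smul_mulVec, sub_eq_zero] at this
    exact this.symm
  have hlin : LinearIndependent ℝ w := by
    refine Module.End.eigenvectors_linearIndependent' (Matrix.toLin' (A⁻¹ * B)) l hl w fun i => ?_
    refine Module.End.hasEigenvector_iff.2 ⟨Module.End.mem_eigenspace_iff.2 ?_, hw0 i⟩
    rw [Matrix.toLin'_apply, ← Matrix.mulVec_mulVec, hBw, Matrix.mulVec_smul, Matrix.mulVec_mulVec,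
      Matrix.nonsing_inv_mul _ hdet.isUnit, Matrix.one_mulVec]
  have horth : ∀ i j, i ≠ j → w i ⬝ᵥ (A *ᵥ w j) = 0 := fun i j hij => by
    have h1 : w i ⬝ᵥ (B *ᵥ w j) = w j ⬝ᵥ (B *ᵥ w i) := by
      rw [Matrix.dotProduct_mulVec, ← Matrix.mulVec_transpose, hB.eq, dotProduct_comm]
    have h2 : w i ⬝ᵥ (A *ᵥ w j) = w j ⬝ᵥ (A *ᵥ w i) := by
      rw [Matrix.dotProduct_mulVec, ← Matrix.mulVec_transpose, hA.eq, dotProduct_comm]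
    rw [hBw, hBw, dotProduct_smul, dotProduct_smul, ← h2, smul_eq_mul, smul_eq_mul,
      ← sub_eq_zero, ← sub_mul] at h1
    exact (mul_eq_zero.1 h1).resolve_left (sub_ne_zero.2 fun h => hij (hl h).symm)
  have entry : ∀ (M : Matrix (Fin 4) (Fin 4) ℝ) i j,
      (Matrix.of w * M * (Matrix.of w)ᵀ) i j = w i ⬝ᵥ (M *ᵥ w j) := fun M i j => by
    rw [Matrix.mul_assoc]; rfl
  have hdA : Matrix.of w * A * (Matrix.of w)ᵀ =
      Matrix.diagonal fun i => w i ⬝ᵥ (A *ᵥ w i) := by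
    ext i j
    rw [entry]
    by_cases hij : i = j
    · subst hij; simp
    · rw [Matrix.diagonal_apply_ne _ hij, horth i j hij]
  refine ⟨(Matrix.of w)ᵀ, fun i => w i ⬝ᵥ (A *ᵥ w i), ?_, by simpa using hdA, ?_⟩
  · have hW : (Matrix.of w).det ≠ 0 := by
      have : IsUnit (Matrix.of w) := Matrix.linearIndependent_rows_iff_isUnit.1 hlin
      exact ((Matrix.isUnit_iff_isUnit_det _).1 this).ne_zero
    have h := congrArg Matrix.det hdA
    rw [Matrix.det_mul, Matrix.det_mul, Matrix.det_transpose, Matrix.det_diagonal] at h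
    have : ∏ i, w i ⬝ᵥ (A *ᵥ w i) ≠ 0 := h ▸ mul_ne_zero (mul_ne_zero hW hdet) hW
    exact fun i => Finset.prod_ne_zero_iff.1 this i (Finset.mem_univ i)
  · ext i j
    rw [Matrix.transpose_transpose, entry, hBw, dotProduct_smul, smul_eq_mul]
    by_cases hij : i = j
    · subst hij; simp [mul_comm]
    · rw [Matrix.diagonal_apply_ne _ hij, horth i j hij, mul_zero]

theorem det_ne_zero_of_congr_diagonal {A W : Matrix (Fin 4) (Fin 4) ℝ} {d : Fin 4 → ℝ}
    (hd : ∀ i, d i ≠ 0) (h : Wᵀ * A * W = Matrix.diagonal d) : W.det ≠ 0 := by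
  intro hW
  have := congrArg Matrix.det h
  rw [Matrix.det_mul, hW, mul_zero, Matrix.det_diagonal] at this
  exact Finset.prod_ne_zero_iff.2 (fun i _ => hd i) this.symm

theorem dotProduct_mulVec_of_congr_diagonal {A W : Matrix (Fin 4) (Fin 4) ℝ} {d : Fin 4 → ℝ}
    (h : Wᵀ * A * W = Matrix.diagonal d) (y : Fin 4 → ℝ) :
    (W *ᵥ y) ⬝ᵥ (A *ᵥ (W *ᵥ y)) = ∑ i, d i * y i ^ 2 := by
  have : (W *ᵥ y) ⬝ᵥ (A *ᵥ (W *ᵥ y)) = y ⬝ᵥ ((Wᵀ * A * W) *ᵥ y) := by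
    rw [← Matrix.mulVec_mulVec, ← Matrix.mulVec_mulVec, Matrix.dotProduct_mulVec y,
      Matrix.vecMul_transpose]
  rw [this, h, dotProduct]
  exact Finset.sum_congr rfl fun i _ => by rw [Matrix.mulVec_diagonal]; ring

/-- Sylvester's law of inertia for a matrix congruent to a diagonal one. -/
theorem index_of_congr_diagonal {D W : Matrix (Fin 4) (Fin 4) ℝ} {e : Fin 4 → ℝ}
    (hW : W.det ≠ 0) (h : Wᵀ * D * W = Matrix.diagonal e) :
    index D = (Finset.univ.filter fun i => 0 < e i).card := by
  have hequiv : QuadraticMap.Equivalent (Matrix.toQuadraticForm' D)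
      (QuadraticMap.weightedSumSquares ℝ e) := by
    refine QuadraticMap.Equivalent.symm ⟨⟨LinearEquiv.ofIsUnitDet (f := Matrix.toLin' W)
      (v := Pi.basisFun ℝ (Fin 4)) (v' := Pi.basisFun ℝ (Fin 4)) ?_, fun y => ?_⟩⟩
    · rw [LinearMap.toMatrix_eq_toMatrix', LinearMap.toMatrix'_toLin']
      exact hW.isUnit
    · have := dotProduct_mulVec_of_congr_diagonal h y
      simp only [QuadraticMap.weightedSumSquares_apply, smul_eq_mul]
      simp only [← pow_two]
      rw [← this]
      simp [Matrix.toQuadraticForm', LinearMap.BilinMap.toQuadraticMap_apply,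
        Matrix.toLinearMap₂'_apply']
  rw [index, QuadraticForm.sigPos_of_equiv_weightedSumSquares hequiv, Set.ncard_eq_toFinset_card']
  congr 1
  ext i; simp

section Pencil

variable {A B W : Matrix (Fin 4) (Fin 4) ℝ} {d l : Fin 4 → ℝ}

theorem pencil_congr_diagonal
    (hA : Wᵀ * A * W = Matrix.diagonal d)
    (hB : Wᵀ * B * W = Matrix.diagonal (fun i => d i * l i)) (x : ℝ) :
    Wᵀ * (x • A - B) * W = Matrix.diagonal (fun i => d i * (x - l i)) := by
  rw [Matrix.mul_sub, Matrix.sub_mul, Matrix.mul_smul, Matrix.smul_mul, hA, hB]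
  ext i j
  by_cases hij : i = j
  · subst hij; simp; ring
  · simp [hij]

theorem det_pencil_eq_zero_iff (hd : ∀ i, d i ≠ 0)
    (hA : Wᵀ * A * W = Matrix.diagonal d)
    (hB : Wᵀ * B * W = Matrix.diagonal (fun i => d i * l i)) (x : ℝ) :
    (x • A - B).det = 0 ↔ ∃ i, l i = x := by
  have hW := det_ne_zero_of_congr_diagonal hd hA
  have h := congrArg Matrix.det (pencil_congr_diagonal hA hB x)
  rw [Matrix.det_mul, Matrix.det_mul, Matrix.det_transpose, Matrix.det_diagonal] at h
  have h1 : (x • A - B).det = 0 ↔ ∏ i, d i * (x - l i) = 0 := by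
    rw [← h]; simp [hW]
  rw [h1, Finset.prod_eq_zero_iff]
  simp [hd, sub_eq_zero, eq_comm]

/-- The roots of a pencil with four distinct roots are simple eigenvalues: the characteristic
polynomial of `A⁻¹ * B` has degree four, so it has no room for a multiple root. -/
theorem finrank_maxGenEigenspace_eq_one (hdet : A.det ≠ 0) (hl : Function.Injective l)
    (hroot : ∀ i, (l i • A - B).det = 0) (i : Fin 4) :
    Module.finrank ℝ (Module.End.maxGenEigenspace (Matrix.toLin' (A⁻¹ * B)) (l i)) = 1 := by
  rw [LinearMap.finrank_maxGenEigenspace_eq, Matrix.charpoly_toLin']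
  set p := (A⁻¹ * B).charpoly with hp
  have hp0 : p ≠ 0 := (Matrix.charpoly_monic _).ne_zero
  have hmem : ∀ j, l j ∈ p.roots := fun j => by
    rw [Polynomial.mem_roots hp0, Polynomial.IsRoot, hp, Matrix.eval_charpoly]
    have : Matrix.scalar (Fin 4) (l j) - A⁻¹ * B = A⁻¹ * (l j • A - B) := by
      rw [Matrix.mul_sub, Matrix.mul_smul, Matrix.nonsing_inv_mul _ hdet.isUnit]
      congr 1
      ext a b; simp [Matrix.diagonal_apply, Matrix.one_apply]
    rw [this, Matrix.det_mul, hroot, mul_zero]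
  have hle : (Finset.univ.map ⟨l, hl⟩).val ≤ p.roots := by
    rw [Multiset.le_iff_subset (Finset.nodup _)]
    intro x hx
    obtain ⟨j, -, rfl⟩ := Finset.mem_map.1 (Finset.mem_def.2 hx)
    exact hmem j
  have hcard : p.roots.card ≤ 4 := by
    simpa [hp, Matrix.charpoly_natDegree_eq_dim] using Polynomial.card_roots' p
  have heq : (Finset.univ.map ⟨l, hl⟩).val = p.roots :=
    Multiset.eq_of_le_of_card_le hle (by simpa using hcard)
  rw [← Polynomial.count_roots, ← heq]
  exact Multiset.count_eq_one_of_mem (Finset.nodup _) (heq ▸ hmem i)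

end Pencil

/-- A nonsingular representative sees all four projective roots of the pencil as real numbers. -/
theorem IsRepresentative.exists_roots {A B A' B' : Matrix (Fin 4) (Fin 4) ℝ}
    (h : IsRepresentative A B A' B') (hroots : (pencilRoots A B).ncard = 4) :
    ∃ l : Fin 4 → ℝ, StrictMono l ∧ ∀ i, (l i • A' - B').det = 0 := by
  obtain ⟨⟨a, b, c, d, hne, rfl, rfl⟩, hdet⟩ := h
  set A' := a • A + b • B
  set B' := c • A + d • B
  have hv : ∀ x : ℝ, (![x * a - c, d - x * b] : Fin 2 → ℝ) ≠ 0 := fun x hx => hne (by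
    have h0 := congrFun hx 0
    have h1 := congrFun hx 1
    simp at h0 h1
    linear_combination a * h1 + b * h0)
  have hM : ∀ x : ℝ, (x * a - c) • A - (d - x * b) • B = x • A' - B' := fun x => by
    simp only [A', B']; module
  let φ : ℝ → RealProj 1 := fun x => Projectivization.mk ℝ _ (hv x)
  have hφ : ∀ x, φ x ∈ pencilRoots A B ↔ (x • A' - B').det = 0 := fun x => by
    rw [mk_mem_pencilRoots, ← hM]; simp
  have hinj : Function.Injective φ := fun x y hxy => by
    obtain ⟨t, ht⟩ := (Projectivization.mk_eq_mk_iff' ℝ _ _ _ _).1 hxy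
    have h0 := congrFun ht 0
    have h1 := congrFun ht 1
    simp at h0 h1
    have ht1 : (t - 1) * (a * d - b * c) = 0 := by linear_combination b * h0 + a * h1
    obtain rfl : t = 1 := by
      have := (mul_eq_zero.1 ht1).resolve_right hne; linarith
    have : (y - x) * (a * d - b * c) = 0 := by linear_combination d * h0 + c * h1
    have := (mul_eq_zero.1 this).resolve_right hne; linarith
  have himg : φ '' {x | (x • A' - B').det = 0} = pencilRoots A B := by
    ext p
    constructor
    · rintro ⟨x, hx, rfl⟩; exact (hφ x).2 hx
    · induction p using Projectivization.ind with | h v hv0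
      intro hp
      have hp' := (mk_mem_pencilRoots _ _ _ _).1 hp
      -- in the coordinates `(A', B')` of the pencil, the root `v` is `[m : n]`
      set m := v 0 * d + v 1 * c with hm
      set n := v 0 * b + v 1 * a with hn
      have key : (a * d - b * c) • (v 0 • A - v 1 • B) = m • A' - n • B' := by
        simp only [A', B', hm, hn]; module
      have hmn : (m • A' - n • B').det = 0 := by rw [← key, Matrix.det_smul, hp', mul_zero]
      have hn0 : n ≠ 0 := fun hn0 => by
        rw [hn0, zero_smul, sub_zero, Matrix.det_smul] at hmn
        have hm0 : m = 0 := by simpa [hdet] using hmn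
        refine hv0 (funext fun i => ?_)
        have e0 : v 0 * (a * d - b * c) = 0 := by
          linear_combination a * hm0 - c * hn0 - a * hm + c * hn
        have e1 : v 1 * (a * d - b * c) = 0 := by
          linear_combination d * hn0 - b * hm0 + b * hm - d * hn
        fin_cases i
        · simpa [hne] using e0
        · simpa [hne] using e1
      have hφp : φ (m / n) = Projectivization.mk ℝ v hv0 := by
        refine (Projectivization.mk_eq_mk_iff' ℝ _ _ _ _).2 ⟨(a * d - b * c) / n, funext fun i => ?_⟩
        fin_cases i
        · simp; field_simp; rw [hm, hn]; ring
        · simp; field_simp; rw [hm, hn]; ring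
      exact ⟨m / n, (hφ _).1 (hφp ▸ hp), hφp⟩
  have hcard : {x : ℝ | (x • A' - B').det = 0}.ncard = 4 := by
    rwa [← himg, Set.ncard_image_of_injective _ hinj] at hroots
  have hfin : {x : ℝ | (x • A' - B').det = 0}.Finite := Set.finite_of_ncard_ne_zero (by omega)
  have hcard' : hfin.toFinset.card = 4 := by rw [← Set.ncard_eq_toFinset_card _ hfin, hcard]
  refine ⟨hfin.toFinset.orderEmbOfFin hcard', (hfin.toFinset.orderEmbOfFin hcard').strictMono,
    fun i => ?_⟩
  exact hfin.mem_toFinset.1 (hfin.toFinset.orderEmbOfFin_mem hcard' i)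

theorem exists_isRepresentative {A B : Matrix (Fin 4) (Fin 4) ℝ}
    (hfin : (pencilRoots A B).Finite) : ∃ A' B', IsRepresentative A B A' B' := by
  have : Infinite (RealProj 1) := by
    refine Infinite.of_injective (fun x : ℝ => (Projectivization.mk ℝ ![x, 1] fun h => by
      simpa using congrFun h 1 : RealProj 1)) fun x y hxy => ?_
    obtain ⟨t, ht⟩ := (Projectivization.mk_eq_mk_iff' ℝ _ _ _ _).1 hxy
    have h0 := congrFun ht 0
    have h1 := congrFun ht 1
    simp at h0 h1
    simpa [h1] using h0.symm
  obtain ⟨p, hp⟩ := hfin.exists_notMem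
  induction p using Projectivization.ind with | h v hv0
  rw [mk_mem_pencilRoots] at hp
  refine ⟨_, _, ⟨v 0, - v 1, v 1, v 0, fun h => hv0 (funext fun i => ?_), rfl, rfl⟩, ?_⟩
  · have h0 : v 0 = 0 := by nlinarith [sq_nonneg (v 0), sq_nonneg (v 1)]
    have h1 : v 1 = 0 := by nlinarith [sq_nonneg (v 0), sq_nonneg (v 1)]
    fin_cases i
    · exact h0
    · exact h1
  · rwa [neg_smul, ← sub_eq_add_neg]

/-- The base locus depends on the pencil only. -/
theorem IsRepresentative.qsic_eq {A B A' B' : Matrix (Fin 4) (Fin 4) ℝ}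
    (h : IsRepresentative A B A' B') : qsic A' B' = qsic A B := by
  obtain ⟨⟨a, b, c, d, hne, rfl, rfl⟩, -⟩ := h
  ext p
  simp only [qsic, Set.mem_ofPred_eq, Matrix.add_mulVec, Matrix.smul_mulVec, dotProduct_add,
    dotProduct_smul, smul_eq_mul]
  generalize p.rep ⬝ᵥ (A *ᵥ p.rep) = s
  generalize p.rep ⬝ᵥ (B *ᵥ p.rep) = t
  constructor
  · rintro ⟨h1, h2⟩
    have e0 : s * (a * d - b * c) = 0 := by linear_combination d * h1 - b * h2
    have e1 : t * (a * d - b * c) = 0 := by linear_combination a * h2 - c * h1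
    exact ⟨by simpa [hne] using e0, by simpa [hne] using e1⟩
  · rintro ⟨rfl, rfl⟩; simp

theorem IsRepresentative.isSymm {A B A' B' : Matrix (Fin 4) (Fin 4) ℝ}
    (h : IsRepresentative A B A' B') (hA : A.IsSymm) (hB : B.IsSymm) :
    A'.IsSymm ∧ B'.IsSymm := by
  obtain ⟨⟨a, b, c, d, -, rfl, rfl⟩, -⟩ := h
  exact ⟨(hA.smul a).add (hB.smul b), (hA.smul c).add (hB.smul d)⟩

/-! ### Combinatorics of index sequences -/

/-- The index sequence of a diagonal pencil. The entry `b i` records whether the coefficient `d i`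
is positive, where the pencil is `∑ i, d i * (x - l i) * y i ^ 2` with `l` increasing. In the `j`-th
interval exactly the `l i` with `i < j` lie below `x`. -/
def signSeq (b : Fin 4 → Bool) (j : Fin 5) : ℕ :=
  (Finset.univ.filter fun i : Fin 4 => b i = decide (i.castSucc < j)).card

/-- Left rotation of an index sequence. -/
def rotate : List ℕ → List ℕ
  | _ :: b :: l => (b :: l) ++ [4 - b]
  | l => l

theorem admissible_rotate {s : List ℕ} (h : Admissible s) :
    Admissible (rotate s) := by
  match s, h with
  | [], h => exact h
  | [a], h => exact h
  | a :: b :: l, h =>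
    obtain ⟨h1, h2, h3⟩ := h
    have hb : b ≤ 4 := h1 b (by simp)
    refine ⟨fun x hx => ?_, by simp [rotate], ?_⟩
    · simp only [rotate, List.mem_append, List.mem_singleton] at hx
      rcases hx with hx | rfl
      · exact h1 x (List.mem_cons_of_mem _ hx)
      · omega
    · simp [rotate]; omega

theorem indexEquiv_rotate {s : List ℕ} (h : Admissible s) : IndexEquiv s (rotate s) := by
  match s, h with
  | [], h => exact .refl _
  | [a], h => exact .refl _
  | a :: b :: l, h => exact .rel _ _ (.rotateLeft a b l h)

theorem indexEquiv_iterate_rotate {s : List ℕ} (h : Admissible s) (n : ℕ) :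
    IndexEquiv s (rotate^[n] s) := by
  suffices Admissible (rotate^[n] s) ∧ IndexEquiv s (rotate^[n] s) from this.2
  induction n with
  | zero => exact ⟨h, .refl _⟩
  | succ n ih =>
    rw [Function.iterate_succ_apply']
    exact ⟨admissible_rotate ih.1, .trans _ _ _ ih.2 (indexEquiv_rotate ih.1)⟩

theorem admissible_ofFn_signSeq (b : Fin 4 → Bool) : Admissible (List.ofFn (signSeq b)) := by
  refine ⟨fun x hx => ?_, by simp, ?_⟩
  · obtain ⟨j, rfl⟩ := (List.mem_ofFn' _ _).1 hx
    exact (Finset.card_le_univ _).trans (by simp)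
  · revert b; decide

/-- Rotations alone bring each of the sixteen sign patterns to one of the two normal forms. -/
theorem signSeq_equiv (b : Fin 4 → Bool) :
    IndexEquiv (List.ofFn (signSeq b)) [1, 2, 1, 2, 3] ∨
      IndexEquiv (List.ofFn (signSeq b)) [0, 1, 2, 3, 4] := by
  have key : ∀ b, (∃ n : Fin 8, rotate^[n] (List.ofFn (signSeq b)) = [1, 2, 1, 2, 3]) ∨
      ∃ n : Fin 8, rotate^[n] (List.ofFn (signSeq b)) = [0, 1, 2, 3, 4] := by decide
  rcases key b with ⟨n, hn⟩ | ⟨n, hn⟩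
  · exact .inl (hn ▸ indexEquiv_iterate_rotate (admissible_ofFn_signSeq b) n)
  · exact .inr (hn ▸ indexEquiv_iterate_rotate (admissible_ofFn_signSeq b) n)

/-- Whether a sequence has an extreme entry (that is, whether the pencil has a definite member) is
invariant under equivalence. Rotation may drop an extreme entry, but by admissibility the opposite
extreme is then at the other end. -/
theorem IndexEquiv.extreme_iff {s t : List ℕ} (h : IndexEquiv s t) :
    (0 ∈ s ∨ 4 ∈ s) ↔ (0 ∈ t ∨ 4 ∈ t) := by
  induction h with
  | refl => rfl
  | symm _ _ _ ih => exact ih.symm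
  | trans _ _ _ _ _ ih₁ ih₂ => exact ih₁.trans ih₂
  | rel s t h =>
    cases h with
    | rotateRight l a b h =>
      obtain ⟨h1, _, h3⟩ := h
      have ha : a ≤ 4 := h1 a (by simp)
      cases l with
      | nil => simp at h3 ⊢; omega
      | cons c l =>
        simp at h3
        by_cases h0 : 0 ∈ l <;> by_cases h4 : 4 ∈ l <;> simp [h0, h4]
        omega
    | rotateLeft a b l h =>
      obtain ⟨h1, _, h3⟩ := h
      have hb : b ≤ 4 := h1 b (by simp)
      rcases List.eq_nil_or_concat l with rfl | ⟨l, c, rfl⟩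
      · simp at h3 ⊢; omega
      · simp [List.getLast_cons] at h3
        by_cases h0 : 0 ∈ l <;> by_cases h4 : 4 ∈ l <;> simp [h0, h4]
        omega
    | reversal s h => simp
    | complement s h =>
      simp only [List.mem_map]
      constructor
      · rintro (h' | h')
        · exact .inr ⟨0, h', rfl⟩
        · exact .inl ⟨4, h', rfl⟩
      · rintro (⟨x, hx, h'⟩ | ⟨x, hx, h'⟩) <;> have := h.1 x hx
        · exact .inr ((by omega : x = 4) ▸ hx)
        · exact .inl ((by omega : x = 0) ▸ hx)

/-- If no entry is extreme, two of the four squares are positive combinations of the other two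
on the common zero set. The conditions say that
`-(d i / d k) * ((l p - l i) / (l p - l k))` and its three analogues are positive. -/
theorem exists_indices_of_not_extreme (b : Fin 4 → Bool)
    (h : ¬ (0 ∈ List.ofFn (signSeq b) ∨ 4 ∈ List.ofFn (signSeq b))) :
    ∃ i j k p : Fin 4, Function.Injective ![i, j, k, p] ∧
      (b i = b k ↔ ¬ (i < p ↔ k < p)) ∧ (b j = b k ↔ ¬ (j < p ↔ k < p)) ∧
      (b i = b p ↔ ¬ (i < k ↔ p < k)) ∧ (b j = b p ↔ ¬ (j < k ↔ p < k)) := by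
  have key : ∀ b, ¬ (0 ∈ List.ofFn (signSeq b) ∨ 4 ∈ List.ofFn (signSeq b)) →
    ∃ k p i j : Fin 4,
      (b i = b k ↔ ¬ (i < p ↔ k < p)) ∧ (b j = b k ↔ ¬ (j < p ↔ k < p)) ∧
      (b i = b p ↔ ¬ (i < k ↔ p < k)) ∧ (b j = b p ↔ ¬ (j < k ↔ p < k)) ∧
        Function.Injective ![i, j, k, p] := by decide +kernel
  obtain ⟨k, p, i, j, h1, h2, h3, h4, h5⟩ := key b h
  exact ⟨i, j, k, p, h5, h1, h2, h3, h4⟩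

/-! ### The topology of the normal form -/

/-- Real projective space is Hausdorff: a line is determined by the matrix of the orthogonal
projection onto it, with entries `vᵢ vⱼ / |v|²`, which depends continuously on the line. -/
instance instT2SpaceRealProj (n : ℕ) : T2Space (RealProj n) := by
  let F : {v : Fin (n + 1) → ℝ // v ≠ 0} → Fin (n + 1) → Fin (n + 1) → ℝ :=
    fun v i j => v.1 i * v.1 j / (v.1 ⬝ᵥ v.1)
  have hpos : ∀ v : {v : Fin (n + 1) → ℝ // v ≠ 0}, v.1 ⬝ᵥ v.1 ≠ 0 := fun v h =>
    v.2 (dotProduct_self_eq_zero.1 h)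
  have hF : ∀ (a b : {v : Fin (n + 1) → ℝ // v ≠ 0}) (t : ℝ), (a : Fin (n + 1) → ℝ) = t • (b : _) →
      F a = F b := fun a b t h => by
    have ht : t ≠ 0 := fun ht => a.2 (by rw [h, ht, zero_smul])
    ext i j
    have hb := hpos b
    simp only [F, h, Pi.smul_apply, smul_eq_mul, smul_dotProduct, dotProduct_smul]
    field_simp
  let G : RealProj n → Fin (n + 1) → Fin (n + 1) → ℝ := Projectivization.lift F hF
  have hG : ∀ v : {v : Fin (n + 1) → ℝ // v ≠ 0}, G (Projectivization.mk' ℝ v) = F v := fun v => rfl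
  refine T2Space.of_injective_continuous (f := G) (fun p q hpq => ?_) ?_
  · induction p using Projectivization.ind with | h v hv
    induction q using Projectivization.ind with | h w hw
    have h : F ⟨v, hv⟩ = F ⟨w, hw⟩ := hpq
    obtain ⟨j, hj⟩ := Function.ne_iff.1 hv
    refine (Projectivization.mk_eq_mk_iff' ℝ _ _ _ _).2
      ⟨(w j / (w ⬝ᵥ w)) * (v ⬝ᵥ v) / v j, funext fun i => ?_⟩
    have hij := congrFun (congrFun h i) j
    have h1 := hpos ⟨v, hv⟩
    have h2 := hpos ⟨w, hw⟩
    have hj' : v j ≠ 0 := hj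
    simp only [F] at hij h1 h2
    simp only [Pi.smul_apply, smul_eq_mul]
    field_simp at hij ⊢
    linear_combination -hij
  · refine continuous_coinduced_dom.2 ?_
    change Continuous F
    have hcont : ∀ i, Continuous fun v : {v : Fin (n + 1) → ℝ // v ≠ 0} => v.1 i := fun i =>
      (continuous_apply i).comp continuous_subtype_val
    refine continuous_pi fun i => continuous_pi fun j => ?_
    refine Continuous.div ?_ ?_ hpos
    · exact (hcont i).mul (hcont j)
    · exact continuous_finsetSum _ fun k _ => (hcont k).mul (hcont k)

/-- The components of a disjoint union of two compact connected sets. -/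
theorem components_union {C D : Set (RealProj 3)} (hC : IsCompact C) (hD : IsCompact D)
    (hC' : IsConnected C) (hD' : IsConnected D) (hdisj : Disjoint C D) :
    components (C ∪ D) = {C, D} := by
  have key : ∀ {C D : Set (RealProj 3)}, IsCompact C → IsCompact D → IsConnected C →
      Disjoint C D → ∀ p ∈ C, connectedComponentIn (C ∪ D) p = C := by
    intro C D hC hD hC' hdisj p hp
    refine Set.Subset.antisymm ?_
      (hC'.isPreconnected.subset_connectedComponentIn hp Set.subset_union_left)
    have hpre : IsPreconnected (connectedComponentIn (C ∪ D) p) := isPreconnected_connectedComponentIn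
    rcases isPreconnected_iff_subset_of_disjoint_closed.1 hpre C D hC.isClosed hD.isClosed
      (connectedComponentIn_subset _ _) (by rw [hdisj.inter_eq, Set.inter_empty]) with h | h
    · exact h
    · exact absurd (h (mem_connectedComponentIn (Or.inl hp))) (Set.disjoint_left.1 hdisj hp)
  have hC1 := key hC hD hC' hdisj
  have hD1 := key hD hC hD' hdisj.symm
  rw [Set.union_comm] at hD1
  obtain ⟨c, hc⟩ := hC'.nonempty
  obtain ⟨e, he⟩ := hD'.nonempty
  ext E
  simp only [components, Set.mem_ofPred_eq, Set.mem_insert_iff, Set.mem_singleton_iff]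
  constructor
  · rintro ⟨p, hp | hp, rfl⟩
    · exact .inl (hC1 p hp)
    · exact .inr (hD1 p hp)
  · rintro (rfl | rfl)
    · exact ⟨c, .inl hc, (hC1 c hc).symm⟩
    · exact ⟨e, .inr he, (hD1 e he).symm⟩

instance instConnectedSpaceCircle : ConnectedSpace Circle := by
  have : IsConnected (Set.range Circle.exp) := isConnected_range Circle.exp.continuous
  rw [Circle.exp_surjective.range_eq] at this
  exact connectedSpace_iff_univ.2 this

theorem circle_sq_add_sq (z : Circle) : (z : ℂ).re ^ 2 + (z : ℂ).im ^ 2 = 1 := by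
  have := Circle.normSq_coe z
  rw [Complex.normSq_apply] at this; linarith

theorem form_pos {a b : ℝ} (ha : 0 < a) (hb : 0 < b) (z : Circle) :
    0 < a * (z : ℂ).re ^ 2 + b * (z : ℂ).im ^ 2 := by
  have h := circle_sq_add_sq z
  rcases (sq_nonneg (z : ℂ).re).eq_or_lt' with h0 | h0
  · rw [h0] at h ⊢; nlinarith
  · nlinarith [mul_pos ha h0, mul_nonneg hb.le (sq_nonneg (z : ℂ).im)]

/-- One of the two branches (according to the sign `s`) of the curve
`y₂² = a y₀² + b y₁²`, `y₃² = c y₀² + d y₁²`, over the circle of directions of `(y₀, y₁)`. -/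
noncomputable def branch (a b c d s : ℝ) (z : Circle) : Fin 4 → ℝ :=
  ![(z : ℂ).re, (z : ℂ).im, √(a * (z : ℂ).re ^ 2 + b * (z : ℂ).im ^ 2),
    s * √(c * (z : ℂ).re ^ 2 + d * (z : ℂ).im ^ 2)]

section Branch

variable {a b c d : ℝ} {W : Matrix (Fin 4) (Fin 4) ℝ}

theorem mulVec_branch_ne_zero (ha : 0 < a) (hb : 0 < b) (hW : W.det ≠ 0) (s : ℝ) (z : Circle) :
    W *ᵥ branch a b c d s z ≠ 0 := fun h => by
  have h2 := congrFun (Matrix.eq_zero_of_mulVec_eq_zero hW h) 2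
  exact (Real.sqrt_pos.2 (form_pos ha hb z)).ne' h2

/-- The branch with sign `s`, moved by the coordinate change `W`, as a curve in `ℙℝ³`. -/
noncomputable def projBranch (ha : 0 < a) (hb : 0 < b) (c d : ℝ) (hW : W.det ≠ 0) (s : ℝ)
    (z : Circle) : RealProj 3 :=
  Projectivization.mk ℝ (W *ᵥ branch a b c d s z) (mulVec_branch_ne_zero ha hb hW s z)

theorem continuous_projBranch (ha : 0 < a) (hb : 0 < b) (c d : ℝ) (hW : W.det ≠ 0) (s : ℝ) :
    Continuous (projBranch ha hb c d hW s) := by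
  have hre : Continuous fun z : Circle => (z : ℂ).re :=
    Complex.continuous_re.comp continuous_subtype_val
  have him : Continuous fun z : Circle => (z : ℂ).im :=
    Complex.continuous_im.comp continuous_subtype_val
  have hbr : Continuous (branch a b c d s) := by
    refine continuous_pi fun i => ?_
    fin_cases i
    · exact hre
    · exact him
    · exact ((hre.pow 2).const_mul a |>.add ((him.pow 2).const_mul b)).sqrt
    · exact ((hre.pow 2).const_mul c |>.add ((him.pow 2).const_mul d)).sqrt.const_mul s
  have hmk : Continuous (Projectivization.mk' ℝ : {v : Fin 4 → ℝ // v ≠ 0} → RealProj 3) :=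
    continuous_coinduced_rng
  exact hmk.comp ((Continuous.matrix_mulVec continuous_const hbr).subtype_mk
    (mulVec_branch_ne_zero ha hb hW s))

theorem projBranch_eq (ha : 0 < a) (hb : 0 < b) (hc : 0 < c) (hd : 0 < d) (hW : W.det ≠ 0)
    {s t : ℝ} {z w : Circle}
    (h : projBranch ha hb c d hW s z = projBranch ha hb c d hW t w) : z = w ∧ s = t := by
  obtain ⟨r, hr⟩ := (Projectivization.mk_eq_mk_iff' ℝ _ _ _ _).1 h
  rw [← Matrix.mulVec_smul] at hr
  have hr' := Matrix.mulVec_injective_of_isUnit ((Matrix.isUnit_iff_isUnit_det _).2 hW.isUnit) hr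
  have h0 : r * (w : ℂ).re = (z : ℂ).re := congrFun hr' 0
  have h1 : r * (w : ℂ).im = (z : ℂ).im := congrFun hr' 1
  have h2 : r * √(a * (w : ℂ).re ^ 2 + b * (w : ℂ).im ^ 2) =
    √(a * (z : ℂ).re ^ 2 + b * (z : ℂ).im ^ 2) := congrFun hr' 2
  have h3 : r * (t * √(c * (w : ℂ).re ^ 2 + d * (w : ℂ).im ^ 2)) =
    s * √(c * (z : ℂ).re ^ 2 + d * (z : ℂ).im ^ 2) := congrFun hr' 3
  have hr2 : r ^ 2 = 1 := by
    have hz := circle_sq_add_sq z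
    rw [← h0, ← h1] at hz
    linear_combination hz - r ^ 2 * circle_sq_add_sq w
  have hrpos : 0 < r :=
    pos_of_mul_pos_left (h2 ▸ Real.sqrt_pos.2 (form_pos ha hb z)) (Real.sqrt_nonneg _)
  obtain rfl : r = 1 := by nlinarith
  rw [one_mul] at h0 h1 h3
  obtain rfl : z = w := Circle.ext (Complex.ext h0.symm h1.symm)
  exact ⟨rfl, (mul_right_cancel₀ (Real.sqrt_pos.2 (form_pos hc hd z)).ne' h3).symm⟩

theorem isOval_range_projBranch (ha : 0 < a) (hb : 0 < b) (hc : 0 < c) (hd : 0 < d)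
    (hW : W.det ≠ 0) (s : ℝ) : IsOval (Set.range (projBranch ha hb c d hW s)) := by
  refine ⟨⟨(((continuous_projBranch ha hb c d hW s).isClosedEmbedding
    fun z w h => (projBranch_eq ha hb hc hd hW h).1).isEmbedding.toHomeomorph).symm⟩, W⁻¹ 2, ?_, ?_⟩
  -- the plane `y₂ = 0`
  · intro h
    have : (W⁻¹ * W) 2 2 = 0 := by
      rw [Matrix.mul_apply]; simp [h]
    rw [Matrix.nonsing_inv_mul _ hW.isUnit] at this
    simp at this
  · rw [Set.disjoint_left]
    rintro _ ⟨z, rfl⟩ h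
    obtain ⟨r, hr⟩ := Projectivization.exists_smul_eq_mk_rep ℝ _
      (mulVec_branch_ne_zero (c := c) (d := d) ha hb hW s z)
    have h' : W⁻¹ 2 ⬝ᵥ (projBranch ha hb c d hW s z).rep = 0 := h
    have h2 : W⁻¹ 2 ⬝ᵥ (W *ᵥ branch a b c d s z) = branch a b c d s z 2 := by
      change (W⁻¹ *ᵥ (W *ᵥ branch a b c d s z)) 2 = _
      rw [Matrix.mulVec_mulVec, Matrix.nonsing_inv_mul _ hW.isUnit, Matrix.one_mulVec]
    rw [projBranch, ← hr, Units.smul_def, dotProduct_smul, h2, smul_eq_mul] at h'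
    exact (Real.sqrt_pos.2 (form_pos ha hb z)).ne' ((mul_eq_zero.1 h').resolve_left r.ne_zero)

/-- In the curve `y₂² = a y₀² + b y₁²`, `y₃² = c y₀² + d y₁²` with positive coefficients `y₂` and
`y₃` never vanish. Normalizing `y₂ > 0` and `y₀² + y₁² = 1` leaves the sign of `y₃` as the only
choice over each point of the circle. -/
theorem ovals_of_normal_form (ha : 0 < a) (hb : 0 < b) (hc : 0 < c) (hd : 0 < d)
    (hW : W.det ≠ 0) {S : Set (RealProj 3)}
    (hS : ∀ (y : Fin 4 → ℝ) (hy : W *ᵥ y ≠ 0), (Projectivization.mk ℝ (W *ᵥ y) hy : RealProj 3) ∈ S ↔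
      y 2 ^ 2 = a * y 0 ^ 2 + b * y 1 ^ 2 ∧ y 3 ^ 2 = c * y 0 ^ 2 + d * y 1 ^ 2) :
    (components S).ncard = 2 ∧ ∀ C ∈ components S, IsOval C := by
  set f := projBranch ha hb c d hW
  have hmem : ∀ s z, s ^ 2 = 1 → f s z ∈ S := fun s z hs => by
    refine (hS _ _).2 ⟨?_, ?_⟩
    · exact Real.sq_sqrt (form_pos ha hb z).le
    · change (s * √(c * (z : ℂ).re ^ 2 + d * (z : ℂ).im ^ 2)) ^ 2 = _
      rw [mul_pow, hs, one_mul]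
      exact Real.sq_sqrt (form_pos hc hd z).le
  have hunion : S = Set.range (f 1) ∪ Set.range (f (-1)) := by
    refine Set.Subset.antisymm (fun p hp => ?_) ?_
    · induction p using Projectivization.ind with | h v hv
      obtain ⟨y, rfl⟩ : ∃ y, W *ᵥ y = v := ⟨W⁻¹ *ᵥ v, by
        rw [Matrix.mulVec_mulVec, Matrix.mul_nonsing_inv _ hW.isUnit, Matrix.one_mulVec]⟩
      obtain ⟨h2, h3⟩ := (hS y hv).1 hp
      have hn : 0 < y 0 ^ 2 + y 1 ^ 2 := by
        refine lt_of_le_of_ne (by positivity) fun h0 => hv ?_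
        have e0 : y 0 = 0 := by nlinarith [sq_nonneg (y 0), sq_nonneg (y 1)]
        have e1 : y 1 = 0 := by nlinarith [sq_nonneg (y 0), sq_nonneg (y 1)]
        have e2 : y 2 = 0 := by simpa [e0, e1] using h2
        have e3 : y 3 = 0 := by simpa [e0, e1] using h3
        have : y = 0 := by ext i; fin_cases i <;> assumption
        rw [this, Matrix.mulVec_zero]
      -- the scale factor that makes `(y 0, y 1)` a unit vector and `y 2` positive
      obtain ⟨r, hr1, hr2⟩ : ∃ r : ℝ, r ^ 2 * (y 0 ^ 2 + y 1 ^ 2) = 1 ∧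
          0 ≤ r * y 2 := by
        have hs := Real.sqrt_pos.2 hn
        have hs2 := Real.sq_sqrt hn.le
        rcases le_total 0 (y 2) with hy | hy
        · refine ⟨(√(y 0 ^ 2 + y 1 ^ 2))⁻¹, ?_, by positivity⟩
          rw [inv_pow, hs2]; field_simp
        · refine ⟨-(√(y 0 ^ 2 + y 1 ^ 2))⁻¹, ?_, ?_⟩
          · rw [neg_sq, inv_pow, hs2]; field_simp
          · rw [neg_mul, ← mul_neg]
            exact mul_nonneg (by positivity) (by linarith)
      let z : Circle := ⟨⟨r * y 0, r * y 1⟩, mem_sphere_zero_iff_norm.2 <| by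
        rw [Complex.norm_def, Complex.normSq_mk, Real.sqrt_eq_one]
        linear_combination hr1⟩
      have hz0 : (z : ℂ).re = r * y 0 := rfl
      have hz1 : (z : ℂ).im = r * y 1 := rfl
      have e2 : √(a * (z : ℂ).re ^ 2 + b * (z : ℂ).im ^ 2) = r * y 2 := by
        rw [hz0, hz1, show a * (r * y 0) ^ 2 + b * (r * y 1) ^ 2 = (r * y 2) ^ 2 by
          rw [mul_pow r (y 2), h2]; ring]
        exact Real.sqrt_sq hr2
      have e3 : √(c * (z : ℂ).re ^ 2 + d * (z : ℂ).im ^ 2) = |r * y 3| := by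
        rw [hz0, hz1, show c * (r * y 0) ^ 2 + d * (r * y 1) ^ 2 = (r * y 3) ^ 2 by
          rw [mul_pow r (y 3), h3]; ring]
        exact Real.sqrt_sq_eq_abs _
      have hf : ∀ s, s * |r * y 3| = r * y 3 → f s z = Projectivization.mk ℝ (W *ᵥ y) hv := by
        intro s hs
        refine (Projectivization.mk_eq_mk_iff' ℝ _ _ _ _).2 ⟨r, ?_⟩
        rw [← Matrix.mulVec_smul]
        congr 1
        ext i
        fin_cases i
        · rfl
        · rfl
        · exact e2.symm
        · simp only [branch, e3, hs]; rfl
      rcases le_total 0 (r * y 3) with h | h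
      · exact .inl ⟨z, hf 1 (by rw [abs_of_nonneg h, one_mul])⟩
      · exact .inr ⟨z, hf (-1) (by rw [abs_of_nonpos h]; ring)⟩
    · rintro _ (⟨z, rfl⟩ | ⟨z, rfl⟩)
      · exact hmem 1 z (by norm_num)
      · exact hmem (-1) z (by norm_num)
  have hcont := continuous_projBranch ha hb c d hW
  have hdisj : Disjoint (Set.range (f 1)) (Set.range (f (-1))) := by
    rw [Set.disjoint_left]
    rintro _ ⟨z, rfl⟩ ⟨w, hw⟩
    have := (projBranch_eq ha hb hc hd hW hw).2
    norm_num at this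
  have hcomp := components_union (isCompact_range (hcont 1)) (isCompact_range (hcont (-1)))
    (isConnected_range (hcont 1)) (isConnected_range (hcont (-1))) hdisj
  rw [hunion, hcomp]
  refine ⟨Set.ncard_pair fun h => ?_, ?_⟩
  · have := hdisj.eq_bot_of_le h.le
    exact (Set.range_nonempty (f 1)).ne_empty this
  · rintro C (rfl | rfl)
    · exact isOval_range_projBranch ha hb hc hd hW 1
    · exact isOval_range_projBranch ha hb hc hd hW (-1)

end Branch

/-! ### Index sequence and base locus of a diagonalized pencil -/

/-- A pair of matrices has at most one index sequence. -/
theorem HasBarIndexSequence.unique {A B : Matrix (Fin 4) (Fin 4) ℝ} {s t : List ℕ}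
    (hs : HasBarIndexSequence A B s) (ht : HasBarIndexSequence A B t) : s = t := by
  obtain ⟨-, r, root, σ, hmono, hroot, -, hbot, htop, hmid, rfl⟩ := hs
  obtain ⟨-, r', root', σ', hmono', hroot', -, hbot', htop', hmid', rfl⟩ := ht
  have hrange : Set.range root = Set.range root' := by
    ext x
    simp only [Set.mem_range]
    rw [← hroot, ← hroot']
  obtain rfl : r = r' := by
    have h := congrArg Set.ncard hrange
    rwa [← Set.image_univ, ← Set.image_univ, Set.ncard_image_of_injective _ hmono.injective,
      Set.ncard_image_of_injective _ hmono'.injective, Set.ncard_univ, Set.ncard_univ,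
      Nat.card_eq_fintype_card, Nat.card_eq_fintype_card, Fintype.card_fin, Fintype.card_fin] at h
  obtain rfl : root = root' := (StrictMono.range_inj hmono hmono').1 hrange
  congr 1
  ext k
  induction k using Fin.cases with
  | zero =>
    obtain ⟨x, h1, h2⟩ := (hbot.and hbot').exists
    rw [← h1, ← h2]
  | succ i =>
    by_cases hi : (i : ℕ) + 1 < r
    · obtain ⟨x, h1, h2⟩ := exists_between (hmono (show i < ⟨i + 1, hi⟩ from Nat.lt_succ_self _))
      rw [← hmid i ⟨i + 1, hi⟩ rfl x h1 h2, ← hmid' i ⟨i + 1, hi⟩ rfl x h1 h2]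
    · have : i.succ = Fin.last r := Fin.ext (by simp; omega)
      obtain ⟨x, h1, h2⟩ := (htop.and htop').exists
      rw [this, ← h1, ← h2]

/-- Each of the five intervals cut out by four real numbers contains a point. -/
theorem exists_mem_interval {l : Fin 4 → ℝ} (hl : StrictMono l) (j : Fin 5) :
    ∃ x, ∀ i, (i.castSucc < j → l i < x) ∧ (¬ i.castSucc < j → x < l i) := by
  have h01 : l 0 < l 1 := hl (by decide)
  have h12 : l 1 < l 2 := hl (by decide)
  have h23 : l 2 < l 3 := hl (by decide)
  have key : ∀ x, ((0 < j → l 0 < x) ∧ (¬ 0 < j → x < l 0)) ∧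
      ((1 < j → l 1 < x) ∧ (¬ 1 < j → x < l 1)) ∧
      ((2 < j → l 2 < x) ∧ (¬ 2 < j → x < l 2)) ∧
      ((3 < j → l 3 < x) ∧ (¬ 3 < j → x < l 3)) →
      ∀ i : Fin 4, (i.castSucc < j → l i < x) ∧ (¬ i.castSucc < j → x < l i) := by
    rintro x ⟨h0, h1, h2, h3⟩ i
    fin_cases i
    exacts [h0, h1, h2, h3]
  fin_cases j
  · refine ⟨l 0 - 1, key _ ?_⟩
    simp; refine ⟨?_, ?_, ?_⟩ <;> linarith
  · refine ⟨(l 0 + l 1) / 2, key _ ?_⟩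
    simp; refine ⟨?_, ?_, ?_, ?_⟩ <;> linarith
  · refine ⟨(l 1 + l 2) / 2, key _ ?_⟩
    simp; refine ⟨?_, ?_, ?_, ?_⟩ <;> linarith
  · refine ⟨(l 2 + l 3) / 2, key _ ?_⟩
    simp; refine ⟨?_, ?_, ?_, ?_⟩ <;> linarith
  · refine ⟨l 3 + 1, key _ ?_⟩
    simp; refine ⟨?_, ?_, ?_⟩ <;> linarith

section Diagonal

variable {A B W : Matrix (Fin 4) (Fin 4) ℝ} {d l : Fin 4 → ℝ}

/-- The sign of a coefficient of the diagonalized pencil in the `j`-th interval. -/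
theorem coeff_pos_iff (hd : ∀ i, d i ≠ 0) {j : Fin 5} {x : ℝ}
    (hx : ∀ i, (i.castSucc < j → l i < x) ∧ (¬ i.castSucc < j → x < l i)) (i : Fin 4) :
    0 < d i * (x - l i) ↔ decide (0 < d i) = decide (i.castSucc < j) := by
  rw [decide_eq_decide]
  by_cases hj : i.castSucc < j
  · have := sub_pos.2 ((hx i).1 hj)
    simp [hj, this]
  · have := sub_neg.2 ((hx i).2 hj)
    rw [mul_pos_iff]
    simp only [hj, this, this.not_gt, and_false, and_true, false_or, iff_false, not_lt]
    exact ⟨le_of_lt, fun h => lt_of_le_of_ne h (hd i)⟩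

theorem index_pencil (hd : ∀ i, d i ≠ 0)
    (hA : Wᵀ * A * W = Matrix.diagonal d)
    (hB : Wᵀ * B * W = Matrix.diagonal (fun i => d i * l i)) {j : Fin 5} {x : ℝ}
    (hx : ∀ i, (i.castSucc < j → l i < x) ∧ (¬ i.castSucc < j → x < l i)) :
    index (x • A - B) = signSeq (fun i => decide (0 < d i)) j := by
  rw [index_of_congr_diagonal (det_ne_zero_of_congr_diagonal hd hA)
    (pencil_congr_diagonal hA hB x), signSeq]
  congr 1
  exact Finset.filter_congr fun i _ => coeff_pos_iff hd hx i

theorem hasBarIndexSequence_signSeq (hdet : A.det ≠ 0) (hl : StrictMono l) (hd : ∀ i, d i ≠ 0)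
    (hA : Wᵀ * A * W = Matrix.diagonal d)
    (hB : Wᵀ * B * W = Matrix.diagonal (fun i => d i * l i)) :
    HasBarIndexSequence A B (List.ofFn (signSeq fun i => decide (0 < d i))) := by
  refine ⟨hdet, 4, l, signSeq fun i => decide (0 < d i), hl,
    fun x => det_pencil_eq_zero_iff hd hA hB x, fun i => ?_, ?_, ?_, ?_, rfl⟩
  · exact finrank_maxGenEigenspace_eq_one hdet hl.injective
      (fun i => (det_pencil_eq_zero_iff hd hA hB _).2 ⟨i, rfl⟩) i
  · filter_upwards [Filter.eventually_all.2 fun i => Filter.eventually_lt_atBot (l i)] with x hx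
    exact index_pencil hd hA hB fun i => ⟨fun h => absurd h (Fin.not_lt_zero _), fun _ => hx i⟩
  · filter_upwards [Filter.eventually_all.2 fun i => Filter.eventually_gt_atTop (l i)] with x hx
    exact index_pencil hd hA hB fun i => ⟨fun _ => hx i, fun h => absurd i.castSucc_lt_last h⟩
  · intro i j hij x h1 h2
    refine index_pencil hd hA hB fun k => ⟨fun h => ?_, fun h => ?_⟩
    · exact (hl.monotone (Fin.castSucc_lt_succ_iff.1 h)).trans_lt h1
    · rw [Fin.castSucc_lt_succ_iff, not_le] at h
      exact h2.trans_le (hl.monotone (Fin.le_def.2 (by rw [hij]; exact h)))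

theorem mk_mulVec_mem_qsic
    (hA : Wᵀ * A * W = Matrix.diagonal d)
    (hB : Wᵀ * B * W = Matrix.diagonal (fun i => d i * l i)) (y : Fin 4 → ℝ) (hy : W *ᵥ y ≠ 0) :
    (Projectivization.mk ℝ (W *ᵥ y) hy : RealProj 3) ∈ qsic A B ↔
      ∑ i, d i * y i ^ 2 = 0 ∧ ∑ i, d i * l i * y i ^ 2 = 0 := by
  rw [mk_mem_qsic, dotProduct_mulVec_of_congr_diagonal hA, dotProduct_mulVec_of_congr_diagonal hB]

/-- An extreme entry of the index sequence is the index of a definite member of the pencil. -/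
theorem qsic_eq_empty (hl : StrictMono l) (hd : ∀ i, d i ≠ 0)
    (hA : Wᵀ * A * W = Matrix.diagonal d)
    (hB : Wᵀ * B * W = Matrix.diagonal (fun i => d i * l i))
    (hext : 0 ∈ List.ofFn (signSeq fun i => decide (0 < d i)) ∨
      4 ∈ List.ofFn (signSeq fun i => decide (0 < d i))) : qsic A B = ∅ := by
  have hW := det_ne_zero_of_congr_diagonal hd hA
  refine Set.eq_empty_iff_forall_notMem.2 fun p hp => ?_
  induction p using Projectivization.ind with | h v hv
  obtain ⟨y, rfl⟩ : ∃ y, W *ᵥ y = v := ⟨W⁻¹ *ᵥ v, by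
    rw [Matrix.mulVec_mulVec, Matrix.mul_nonsing_inv _ hW.isUnit, Matrix.one_mulVec]⟩
  obtain ⟨h1, h2⟩ := (mk_mulVec_mem_qsic hA hB y hv).1 hp
  have hsum : ∀ x, ∑ i, d i * (x - l i) * y i ^ 2 = 0 := fun x => by
    have : ∑ i, d i * (x - l i) * y i ^ 2 =
        x * ∑ i, d i * y i ^ 2 - ∑ i, d i * l i * y i ^ 2 := by
      rw [Finset.mul_sum, ← Finset.sum_sub_distrib]
      exact Finset.sum_congr rfl fun i _ => by ring
    rw [this, h1, h2, mul_zero, sub_zero]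
  suffices hy : ∃ e : Fin 4 → ℝ, (∀ i, 0 < e i) ∧ ∑ i, e i * y i ^ 2 = 0 by
    obtain ⟨e, he, he0⟩ := hy
    refine hv ?_
    have : y = 0 := funext fun i => by
      have := (Finset.sum_eq_zero_iff_of_nonneg
        fun i _ => mul_nonneg (he i).le (sq_nonneg (y i))).1 he0 i (Finset.mem_univ i)
      simpa [(he i).ne'] using this
    rw [this, Matrix.mulVec_zero]
  rcases hext with h | h <;> obtain ⟨j, hj⟩ := (List.mem_ofFn' _ _).1 h <;>
    obtain ⟨x, hx⟩ := exists_mem_interval hl j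
  · refine ⟨fun i => -(d i * (x - l i)), fun i => ?_, by simpa [neg_mul] using hsum x⟩
    have hj' := Finset.filter_eq_empty_iff.1 (Finset.card_eq_zero.1 hj) (Finset.mem_univ i)
    rw [← coeff_pos_iff hd hx i, not_lt] at hj'
    refine neg_pos.2 (lt_of_le_of_ne hj' (mul_ne_zero (hd i) (sub_ne_zero.2 ?_)))
    by_cases hi : i.castSucc < j
    · exact ((hx i).1 hi).ne'
    · exact ((hx i).2 hi).ne
  · refine ⟨fun i => d i * (x - l i), fun i => (coeff_pos_iff hd hx i).2 ?_, hsum x⟩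
    have := (Finset.card_eq_iff_eq_univ _).1 (hj.trans (Fintype.card_fin 4).symm)
    exact Finset.filter_eq_self.1 this i (Finset.mem_univ i)

/-- The sign of the coefficient of `y i ^ 2` when `y k ^ 2` is expressed by eliminating `y p`. -/
theorem elimination_coeff_pos (hl : StrictMono l) (hd : ∀ i, d i ≠ 0) {i k p : Fin 4}
    (hip : i ≠ p) (hkp : k ≠ p)
    (h : decide (0 < d i) = decide (0 < d k) ↔ ¬ (i < p ↔ k < p)) :
    0 < -(d i * (l p - l i)) / (d k * (l p - l k)) := by
  have sgn : ∀ i, i ≠ p → (0 < d i * (l p - l i) ↔ (0 < d i ↔ i < p)) := fun i hi => by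
    rcases lt_or_gt_of_ne hi with h | h
    · have := sub_pos.2 (hl h)
      simp [h, this]
    · have := sub_neg.2 (hl h)
      rw [mul_pos_iff]
      simp only [this, h.not_gt, this.not_gt, and_false, and_true, false_or, iff_false, not_lt]
      exact ⟨le_of_lt, fun h => lt_of_le_of_ne h (hd i)⟩
  have ne : ∀ i, i ≠ p → d i * (l p - l i) ≠ 0 := fun i hi =>
    mul_ne_zero (hd i) (sub_ne_zero.2 fun h => hi (hl.injective h.symm))
  rw [decide_eq_decide] at h
  have hopp : 0 < d i * (l p - l i) ↔ ¬ 0 < d k * (l p - l k) := by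
    rw [sgn i hip, sgn k hkp]; tauto
  by_cases hi : 0 < d i * (l p - l i)
  · exact div_pos_of_neg_of_neg (neg_neg_of_pos hi)
      (lt_of_le_of_ne (not_lt.1 (hopp.1 hi)) (ne k hkp))
  · exact div_pos (neg_pos.2 (lt_of_le_of_ne (not_lt.1 hi) (ne i hip)))
      (not_not.1 fun hk => hi (hopp.2 hk))

/-- Without a definite member, solving the two equations for a suitable pair of squares brings
the curve into the normal form of `ovals_of_normal_form`. -/
theorem qsic_ovals (hl : StrictMono l) (hd : ∀ i, d i ≠ 0)
    (hA : Wᵀ * A * W = Matrix.diagonal d)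
    (hB : Wᵀ * B * W = Matrix.diagonal (fun i => d i * l i))
    (hext : ¬ (0 ∈ List.ofFn (signSeq fun i => decide (0 < d i)) ∨
      4 ∈ List.ofFn (signSeq fun i => decide (0 < d i)))) :
    (components (qsic A B)).ncard = 2 ∧ ∀ C ∈ components (qsic A B), IsOval C := by
  obtain ⟨i, j, k, p, hinj, h1, h2, h3, h4⟩ := exists_indices_of_not_extreme _ hext
  set e : Fin 4 → Fin 4 := ![i, j, k, p] with he
  have hip : i ≠ p := hinj.ne (show (0 : Fin 4) ≠ 3 by decide)
  have hjp : j ≠ p := hinj.ne (show (1 : Fin 4) ≠ 3 by decide)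
  have hkp : k ≠ p := hinj.ne (show (2 : Fin 4) ≠ 3 by decide)
  have hik : i ≠ k := hinj.ne (show (0 : Fin 4) ≠ 2 by decide)
  have hjk : j ≠ k := hinj.ne (show (1 : Fin 4) ≠ 2 by decide)
  have hcongr : ∀ (M : Matrix (Fin 4) (Fin 4) ℝ) (c : Fin 4 → ℝ), Wᵀ * M * W = Matrix.diagonal c →
      (W.submatrix id e)ᵀ * M * W.submatrix id e = Matrix.diagonal (c ∘ e) := fun M c h => by
    rw [← Matrix.submatrix_diagonal _ _ hinj, ← h]
    rfl
  have hA' := hcongr A d hA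
  have hB' : (W.submatrix id e)ᵀ * B * W.submatrix id e =
    Matrix.diagonal fun m => (d ∘ e) m * (l ∘ e) m := hcongr B _ hB
  have hW' := det_ne_zero_of_congr_diagonal (fun m => hd (e m)) hA'
  refine ovals_of_normal_form (elimination_coeff_pos hl hd hip hkp h1)
    (elimination_coeff_pos hl hd hjp hkp h2) (elimination_coeff_pos hl hd hik hkp.symm h3)
    (elimination_coeff_pos hl hd hjk hkp.symm h4) hW' fun y hy => ?_
  rw [mk_mulVec_mem_qsic hA' hB', Fin.sum_univ_four, Fin.sum_univ_four]
  change d i * y 0 ^ 2 + d j * y 1 ^ 2 + d k * y 2 ^ 2 + d p * y 3 ^ 2 = 0 ∧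
    d i * l i * y 0 ^ 2 + d j * l j * y 1 ^ 2 + d k * l k * y 2 ^ 2 + d p * l p * y 3 ^ 2 = 0 ↔ _
  have hdk := hd k
  have hdp := hd p
  have hlpk : l p - l k ≠ 0 := sub_ne_zero.2 fun h => hkp (hl.injective h.symm)
  have hlkp : l k - l p ≠ 0 := sub_ne_zero.2 fun h => hkp (hl.injective h)
  have hk : y 2 ^ 2 = -(d i * (l p - l i)) / (d k * (l p - l k)) * y 0 ^ 2 +
      -(d j * (l p - l j)) / (d k * (l p - l k)) * y 1 ^ 2 ↔
      d k * (l p - l k) * y 2 ^ 2 + d i * (l p - l i) * y 0 ^ 2 + d j * (l p - l j) * y 1 ^ 2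
        = 0 := by
    field_simp
    constructor <;> intro h <;> linarith
  have hp : y 3 ^ 2 = -(d i * (l k - l i)) / (d p * (l k - l p)) * y 0 ^ 2 +
      -(d j * (l k - l j)) / (d p * (l k - l p)) * y 1 ^ 2 ↔
      d p * (l k - l p) * y 3 ^ 2 + d i * (l k - l i) * y 0 ^ 2 + d j * (l k - l j) * y 1 ^ 2
        = 0 := by
    field_simp
    constructor <;> intro h <;> linarith
  rw [hk, hp]
  constructor
  · rintro ⟨e1, e2⟩
    exact ⟨by linear_combination l p * e1 - e2, by linear_combination l k * e1 - e2⟩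
  · rintro ⟨e1, e2⟩
    constructor <;> refine (mul_right_inj' hlpk).1 ?_
    · linear_combination e1 - e2
    · linear_combination l k * e1 - l p * e2

end Diagonal

end QuadricPencil

theorem theorem4 (A B : Matrix (Fin 4) (Fin 4) ℝ) (hA : A.IsSymm) (hB : B.IsSymm)
    (hroots : (QuadricPencil.pencilRoots A B).ncard = 4) :
    (∃ A' B', QuadricPencil.IsRepresentative A B A' B') ∧
    (∀ A' B', QuadricPencil.IsRepresentative A B A' B' →
      ∃ s, QuadricPencil.HasBarIndexSequence A' B' s) ∧
    (∀ A' B' s, QuadricPencil.IsRepresentative A B A' B' →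
      QuadricPencil.HasBarIndexSequence A' B' s →
        (QuadricPencil.IndexEquiv s [1, 2, 1, 2, 3] ∨
          QuadricPencil.IndexEquiv s [0, 1, 2, 3, 4]) ∧
        (QuadricPencil.IndexEquiv s [1, 2, 1, 2, 3] →
          (QuadricPencil.components (QuadricPencil.qsic A B)).ncard = 2 ∧
          ∀ C ∈ QuadricPencil.components (QuadricPencil.qsic A B), QuadricPencil.IsOval C) ∧
        (QuadricPencil.IndexEquiv s [0, 1, 2, 3, 4] →
          QuadricPencil.qsic A B = ∅)) := by
  open QuadricPencil in
  have diag : ∀ A' B', IsRepresentative A B A' B' →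
      ∃ (W : Matrix (Fin 4) (Fin 4) ℝ) (d l : Fin 4 → ℝ), StrictMono l ∧ (∀ i, d i ≠ 0) ∧
        Wᵀ * A' * W = Matrix.diagonal d ∧ Wᵀ * B' * W = Matrix.diagonal (fun i => d i * l i) :=
    fun A' B' h => by
      obtain ⟨l, hl, hroot⟩ := h.exists_roots hroots
      obtain ⟨hA', hB'⟩ := h.isSymm hA hB
      obtain ⟨W, d, hd, h1, h2⟩ := exists_diagonalization hA' hB' h.2 hl.injective hroot
      exact ⟨W, d, l, hl, hd, h1, h2⟩
  refine ⟨QuadricPencil.exists_isRepresentative (Set.finite_of_ncard_ne_zero (by omega)),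
    fun A' B' h => ?_, fun A' B' s h hs => ?_⟩
  · obtain ⟨W, d, l, hl, hd, h1, h2⟩ := diag A' B' h
    exact ⟨_, QuadricPencil.hasBarIndexSequence_signSeq h.2 hl hd h1 h2⟩
  · obtain ⟨W, d, l, hl, hd, h1, h2⟩ := diag A' B' h
    obtain rfl := hs.unique (QuadricPencil.hasBarIndexSequence_signSeq h.2 hl hd h1 h2)
    rw [← h.qsic_eq]
    exact ⟨QuadricPencil.signSeq_equiv _,
      fun he => QuadricPencil.qsic_ovals hl hd h1 h2 (by rw [he.extreme_iff]; decide),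
      fun he => QuadricPencil.qsic_eq_empty hl hd h1 h2 (by rw [he.extreme_iff]; decide)⟩
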